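/- For $n\in\mathbb Z$ let $\lambda_n=-in(n^4+n^2-1)$, and let $\mathbb Z^*=\mathbb Z\setminus\{0\}$. With $\operatorname{sinc} w=\frac{\sin w}{w}$, $\operatorname{sinc} 0=1$, put $$P_m(z)=\prod_{n\in\mathbb Z^*,\,n\ne m}\Big(1+\frac{iz}{\lambda_n}\Big)\frac{\lambda_n}{\lambda_n-\lambda_m}\quad(m\in\mathbb Z^*),\qquad M_k(z)=\prod_{n=k^3}^{\infty}\operatorname{sinc}\Big(\frac{z}{n^2}\Big)\quad(k\ge1).$$ For an integer $N\ge1$ and a real $\delta>0$ let $$\Psi_m(z)=P_m(z)\left(\frac{M_{|m|}(z)}{M_{|m|}(i\lambda_m)}\right)^{N}\operatorname{sinc}\big(\delta(z-i\lambda_m)\big),\qquad \Theta_m(t)=\frac1{2\pi}\int_{\mathbb R}\Psi_m(x)e^{itx}\,dx .$$ **Theorem.** Let $N\ge1$ be an integer and $\delta>0$. There are constants $T_1>0$, $C>0$ and $b>0$ such that $(\Theta_m)_{m\in\mathbb Z^*}$ is a biorthogonal sequence to $(e^{-\lambda_n t})_{n\in\mathbb Z^*}$ in $L^2(-\frac{T_1}2,\frac{T_1}2)$,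 i.e. all these functions are in $L^2(-\frac{T_1}2,\frac{T_1}2)$ and $$\int_{-T_1/2}^{T_1/2}\Theta_m(t)\,\overline{e^{-\lambda_n t}}\,dt=\delta_{mn}\qquad(m,n\in\mathbb Z^*),$$ where $\delta_{mn}$ is the Kronecker symbol, and $$\|\Theta_m\|_{L^2(-\frac{T_1}2,\frac{T_1}2)}\le C\,e^{b m^6}\qquad(m\in\mathbb Z^*).$$ Moreover, for every $m\in\mathbb Z^*$: the products $P_m(z)$ and $M_{|m|}(z)$ converge unconditionally for all $z\in\mathbb C$ and $M_{|m|}(i\lambda_m)\ne0$; $\Psi_m$ is an entire function of exponential type at most $\frac{T_1}2$, in the sense that $|\Psi_m(z)|\le K_m e^{\frac{T_1}2|z|}$ for all $z\in\mathbb C$ with some constant $K_m$; $\Psi_m(i\lambda_n)=\delta_{mn}$ for all $n\in\mathbb Z^*$; the restriction of $\Psi_m$ to $\mathbb R$ is in $L^1(\mathbb R)\cap L^2(\mathbb R)$; and $\Theta_m$ vanishes outside $(-\frac{T_1}2,\frac{T_1}2)$. -/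

import Mathlib

open MeasureTheory

noncomputable section

/-- The eigenvalues `λ_n = -i n (n⁴ + n² - 1)` of the linear Kawahara operator
`∂ₓ⁵ - ∂ₓ³ - ∂ₓ` with `2π`-periodic boundary conditions. -/
def eigval (n : ℤ) : ℂ := -Complex.I * n * ((n : ℂ) ^ 4 + (n : ℂ) ^ 2 - 1)

/-- The entire function `sin z / z`, with value `1` at `z = 0`. -/
def csinc (z : ℂ) : ℂ := if z = 0 then 1 else Complex.sin z / z

/-- The factor with index `n` of the product `P_m`. -/
def factorP (m n : ℤ) (z : ℂ) : ℂ :=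
  (1 + Complex.I * z / eigval n) * (eigval n / (eigval n - eigval m))

/-- `P_m(z) = ∏ (1 + i z / λ_n) (λ_n / (λ_n - λ_m))` over all integers `n ∉ {0, m}`. -/
def prodP (m : ℤ) (z : ℂ) : ℂ := ∏' n : {n : ℤ // n ≠ 0 ∧ n ≠ m}, factorP m n z

/-- The factor `sin (z / n²) / (z / n²)` of the product `M_k`. -/
def factorM (n : ℕ) (z : ℂ) : ℂ := csinc (z / (n : ℂ) ^ 2)

/-- `M_k(z) = ∏_{n ≥ k³} sin (z / n²) / (z / n²)`, used for `k ≥ 1`. -/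
def prodM (k : ℕ) (z : ℂ) : ℂ := ∏' n : {n : ℕ // k ^ 3 ≤ n}, factorM n z

/-- `Ψ_m(z) = P_m(z) (M_{|m|}(z) / M_{|m|}(i λ_m))^N sin (δ (z - i λ_m)) / (δ (z - i λ_m))`. -/
def Psi (N : ℕ) (δ : ℝ) (m : ℤ) (z : ℂ) : ℂ :=
  prodP m z * (prodM m.natAbs z / prodM m.natAbs (Complex.I * eigval m)) ^ N *
    csinc (δ * (z - Complex.I * eigval m))

/-- The inverse Fourier transform `t ↦ (1 / 2π) ∫ F(x) e^{itx} dx` over the real line. -/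
def invFourier (F : ℂ → ℂ) (t : ℝ) : ℂ :=
  1 / (2 * (Real.pi : ℂ)) * ∫ x : ℝ, F x * Complex.exp (Complex.I * t * x)

/-- `F` is entire of exponential type at most `τ`, with `|F(z)| ≤ K e^{τ |z|}` for some `K`. -/
def EntireOfExpType (F : ℂ → ℂ) (τ : ℝ) : Prop :=
  Differentiable ℂ F ∧ ∃ K : ℝ, ∀ z : ℂ, ‖F z‖ ≤ K * Real.exp (τ * ‖z‖)

/-- `(Θ_m)` is biorthogonal to `(e_n)` in `L²(-T/2, T/2)`: all functions are square integrable
there and `∫ Θ_m(t) conj(e_n(t)) dt = δ_{mn}`. -/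
def BiorthogonalL2 {ι : Type*} [DecidableEq ι] (T : ℝ) (Θ e : ι → ℝ → ℂ) : Prop :=
  (∀ m, MemLp (Θ m) 2 (volume.restrict (Set.Ioo (-T / 2) (T / 2)))) ∧
  (∀ n, MemLp (e n) 2 (volume.restrict (Set.Ioo (-T / 2) (T / 2)))) ∧
  ∀ m n, ∫ t in Set.Ioo (-T / 2) (T / 2), Θ m t * (starRingEnd ℂ) (e n t) =
    if m = n then 1 else 0

end

/-! Put `μ_n = i λ_n = dispersion n`, a real number. Since the conjugate of `e^{-λ_n t}` is `e^{-i
μ_n t}`, biorthogonality says that the Fourier transform of `Θ_m` takes the value `δ_{mn}` at `μ_n`.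
The product `P_m` interpolates these values but grows on the real line, like `exp(c |z|^{1/4})` at
most (`norm_prodP_le`). One copy of `M_{|m|}` decays like `exp(-√|z|/2)` up to its exponential type
(`norm_prodM_le_decay`), which absorbs that growth and leaves room for a factor `1/(1 + |z|²)`.

Normalising at `μ_m` costs only `e^{O(m⁶)}`: the product `M_{|m|}` starts at `|m|³`, so its
arguments at `μ_m` are at most `1` in modulus (`exp_neg_le_norm_prodM`).

All this merges into one estimate, `exists_norm_Psi_le`: `|Ψ_m(z)| ≤ C e^{b m⁶} e^{τ|Im z|} / (1 +
|z|²)` with `τ = N ∑ 1/n² + δ`. A contour shift and Fourier inversion then give the support, the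
norm bound and biorthogonality, with `T₁ = 2τ`. -/

noncomputable section

open Complex Filter Topology

/-! ### Infinite products: norm bounds and holomorphy. -/

section InfiniteProducts

variable {ι : Type*}

/-- The exponents `g i` may be negative; this is what turns small factors into decay of the product.
-/
theorem norm_tprod_le_exp_tsum {f : ι → ℂ} {g : ι → ℝ} (hf : Multipliable f) (hg : Summable g)
    (h : ∀ i, ‖f i‖ ≤ Real.exp (g i)) : ‖∏' i, f i‖ ≤ Real.exp (∑' i, g i) := by
  refine le_of_tendsto_of_tendsto hf.hasProd.norm
    ((Real.continuous_exp.tendsto _).comp hg.hasSum) (Eventually.of_forall fun s => ?_)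
  simp only [Function.comp, Real.exp_sum]
  exact Finset.prod_le_prod (fun i _ => norm_nonneg _) fun i _ => h i

theorem exp_tsum_le_norm_tprod {f : ι → ℂ} {g : ι → ℝ} (hf : Multipliable f) (hg : Summable g)
    (h : ∀ i, Real.exp (g i) ≤ ‖f i‖) : Real.exp (∑' i, g i) ≤ ‖∏' i, f i‖ := by
  refine le_of_tendsto_of_tendsto ((Real.continuous_exp.tendsto _).comp hg.hasSum)
    hf.hasProd.norm (Eventually.of_forall fun s => ?_)
  simp only [Function.comp, Real.exp_sum]
  exact Finset.prod_le_prod (fun i _ => (Real.exp_pos _).le) fun i _ => h i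

theorem multipliable_of_summable_bound {f : ι → ℂ → ℂ}
    (h : ∀ R : ℝ, ∃ u : ι → ℝ, Summable u ∧ ∀ i, ∀ z : ℂ, ‖z‖ ≤ R → ‖f i z - 1‖ ≤ u i) (z : ℂ) :
    Multipliable fun i => f i z := by
  obtain ⟨u, hu, hb⟩ := h ‖z‖
  have := multipliable_one_add_of_summable (f := fun i => f i z - 1)
    (Summable.of_nonneg_of_le (fun i => norm_nonneg _) (fun i => hb i z le_rfl) hu)
  simpa using this

/-- The bounds on balls make the partial products converge locally uniformly, and such limits of
holomorphic functions are holomorphic. -/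
theorem differentiable_tprod {f : ι → ℂ → ℂ} (hd : ∀ i, Differentiable ℂ (f i))
    (h : ∀ R : ℝ, ∃ u : ι → ℝ, Summable u ∧ ∀ i, ∀ z : ℂ, ‖z‖ ≤ R → ‖f i z - 1‖ ≤ u i) :
    Differentiable ℂ fun z => ∏' i, f i z := by
  intro z
  obtain ⟨u, hu, hb⟩ := h (‖z‖ + 1)
  have hopen : IsOpen (Metric.ball (0 : ℂ) (‖z‖ + 1)) := Metric.isOpen_ball
  have key := Summable.hasProdLocallyUniformlyOn_one_add (f := fun i z => f i z - 1)
    (hK := hopen) (hu := hu)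
    (Eventually.of_forall fun i x hx => hb i x (mem_ball_zero_iff.1 hx).le)
    (fun i => ((hd i).sub_const 1).continuous.continuousOn)
  rw [hasProdLocallyUniformlyOn_iff_tendstoLocallyUniformlyOn] at key
  have hdiff := key.differentiableOn (Eventually.of_forall fun s => by
    have : Differentiable ℂ fun z => ∏ i ∈ s, (1 + (f i z - 1)) := by
      refine Differentiable.fun_finsetProd fun i _ => ?_
      exact ((hd i).sub_const 1).const_add 1
    exact this.differentiableOn) hopen
  simp only [add_sub_cancel] at hdiff
  exact hdiff.differentiableAt (hopen.mem_nhds (by simp))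

end InfiniteProducts

/-! ### Estimates for sinc. -/

section Sinc

theorem norm_cos_le_exp_abs_im (w : ℂ) : ‖Complex.cos w‖ ≤ Real.exp |w.im| := by
  have h1 : ‖cexp (w * I)‖ ≤ Real.exp |w.im| := by
    rw [Complex.norm_exp]; simpa using neg_le_abs _
  have h2 : ‖cexp (-w * I)‖ ≤ Real.exp |w.im| := by
    rw [Complex.norm_exp]; simpa using le_abs_self _
  rw [Complex.cos, norm_div, Complex.norm_ofNat]
  linarith [norm_add_le (cexp (w * I)) (cexp (-w * I))]

theorem norm_sin_le_exp_abs_im (w : ℂ) : ‖Complex.sin w‖ ≤ Real.exp |w.im| := by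
  have h1 : ‖cexp (w * I)‖ ≤ Real.exp |w.im| := by
    rw [Complex.norm_exp]; simpa using neg_le_abs _
  have h2 : ‖cexp (-w * I)‖ ≤ Real.exp |w.im| := by
    rw [Complex.norm_exp]; simpa using le_abs_self _
  rw [Complex.sin, norm_div, norm_mul, Complex.norm_I, Complex.norm_ofNat]
  linarith [norm_sub_le (cexp (-w * I)) (cexp (w * I))]

theorem csinc_zero : csinc 0 = 1 := by simp [csinc]

theorem csinc_eq_dslope : csinc = dslope Complex.sin 0 := by
  ext z
  rcases eq_or_ne z 0 with rfl | hz
  · simp [csinc]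
  · simp [csinc, hz, dslope_of_ne _ hz, slope_def_field]

theorem differentiable_csinc : Differentiable ℂ csinc := by
  rw [csinc_eq_dslope, ← differentiableOn_univ, Complex.differentiableOn_dslope univ_mem]
  exact Complex.differentiable_sin.differentiableOn

/-- Mean value inequality for `sin` between `0` and `w`, inside the convex strip `|Im v| ≤ |Im w|`,
where `|cos v| ≤ e^{|Im w|}`. -/
theorem norm_csinc_le_exp_abs_im (w : ℂ) : ‖csinc w‖ ≤ Real.exp |w.im| := by
  rcases eq_or_ne w 0 with rfl | hw
  · simp [csinc]
  have hconv : Convex ℝ {v : ℂ | |v.im| ≤ |w.im|} := by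
    have : {v : ℂ | |v.im| ≤ |w.im|} = Complex.imLm ⁻¹' Set.Icc (-|w.im|) |w.im| := by
      ext v; simp [abs_le]
    rw [this]
    exact (convex_Icc _ _).linear_preimage _
  have := hconv.norm_image_sub_le_of_norm_deriv_le (𝕜 := ℂ) (f := Complex.sin) (x := 0) (y := w)
    (C := Real.exp |w.im|) (fun v _ => Complex.differentiable_sin v)
    (fun v hv => by
      rw [Complex.deriv_sin]
      exact (norm_cos_le_exp_abs_im v).trans (Real.exp_le_exp.2 hv)) (by simp) (by simp)
  rw [csinc, if_neg hw, norm_div, div_le_iff₀ (norm_pos_iff.2 hw)]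
  simpa using this

theorem norm_csinc_le_div (w : ℂ) (hw : w ≠ 0) : ‖csinc w‖ ≤ Real.exp |w.im| / ‖w‖ := by
  rw [csinc, if_neg hw, norm_div]
  gcongr
  exact norm_sin_le_exp_abs_im w

/-- Mean value inequality twice, for `cos` and then for `sin v - v`. First order in `w` is enough,
because `w = z/n²` is already summable. -/
theorem norm_csinc_sub_one_le (w : ℂ) : ‖csinc w - 1‖ ≤ ‖w‖ * Real.exp ‖w‖ := by
  rcases eq_or_ne w 0 with rfl | hw
  · simp [csinc]
  have hball : Convex ℝ (Metric.closedBall (0 : ℂ) ‖w‖) := convex_closedBall _ _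
  have hcos : ∀ v ∈ Metric.closedBall (0 : ℂ) ‖w‖,
      ‖Complex.cos v - 1‖ ≤ ‖w‖ * Real.exp ‖w‖ := by
    intro v hv
    have := hball.norm_image_sub_le_of_norm_deriv_le (𝕜 := ℂ) (f := Complex.cos) (x := 0) (y := v)
      (C := Real.exp ‖w‖) (fun v _ => Complex.differentiable_cos v)
      (fun v hv => by
        rw [Complex.deriv_cos, norm_neg]
        exact (norm_sin_le_exp_abs_im v).trans (Real.exp_le_exp.2
          ((Complex.abs_im_le_norm v).trans (by simpa using hv)))) (by simp) hv
    rw [Complex.cos_zero, sub_zero] at this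
    refine this.trans ?_
    rw [mul_comm]
    gcongr
    simpa using hv
  have := hball.norm_image_sub_le_of_norm_deriv_le (𝕜 := ℂ) (f := fun v => Complex.sin v - v)
    (x := 0) (y := w) (C := ‖w‖ * Real.exp ‖w‖)
    (fun v _ => (Complex.differentiable_sin v).sub differentiableAt_id)
    (fun v hv => by
      rw [deriv_fun_sub (Complex.differentiable_sin v) differentiableAt_fun_id, Complex.deriv_sin,
        deriv_id'']
      exact hcos v hv) (by simp) (by simp)
  have h2 : csinc w - 1 = (Complex.sin w - w) / w := by
    rw [csinc, if_neg hw, sub_div, div_self hw]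
  rw [h2, norm_div, div_le_iff₀ (norm_pos_iff.2 hw)]
  simpa using this

/-- With `a = |x|`, combine `sin a > a - a³/6`, `e^a ≥ 1 + a` and `(1 + a)(1 - a²/6) ≥ 1` for `0 ≤ a
≤ 1`. -/
theorem exp_neg_abs_le_norm_csinc (x : ℝ) (hx : |x| ≤ 1) : Real.exp (-|x|) ≤ ‖csinc x‖ := by
  rcases eq_or_ne x 0 with rfl | hx0
  · simp [csinc]
  have hpos : 0 < |x| := abs_pos.2 hx0
  have hs : Real.sin |x| / |x| ≤ ‖csinc x‖ := by
    rw [csinc, if_neg (by exact_mod_cast hx0), norm_div, ← Complex.ofReal_sin, Complex.norm_real,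
      Complex.norm_real, Real.norm_eq_abs, Real.norm_eq_abs]
    gcongr
    rcases abs_choice x with h | h <;> rw [h]
    · exact le_abs_self _
    · rw [Real.sin_neg]; exact neg_le_abs _
  refine le_trans ?_ hs
  have h1 := Real.sin_gt_sub_cube hpos
  rw [le_div_iff₀ hpos, Real.exp_neg, inv_mul_le_iff₀ (Real.exp_pos _)]
  have h2 := Real.add_one_le_exp |x|
  set a := |x|
  have h3 : 0 ≤ a - a ^ 3 / 6 := by nlinarith [mul_pos hpos hpos]
  calc a ≤ (a + 1) * (a - a ^ 3 / 6) := by nlinarith [mul_pos hpos hpos, pow_pos hpos 3]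
    _ ≤ Real.exp a * Real.sin a := by
      apply mul_le_mul h2 h1.le h3 (Real.exp_pos _).le

end Sinc

/-! ### Paley–Wiener: inverse Fourier transforms of entire functions with decay. -/

section PaleyWiener

/-- Cauchy's theorem on the rectangle `[-R, R] × [0, R]`: the three sides off the real axis have
total length `4R` and `|G| ≤ A/R²` there, so they contribute at most `4A/R`. -/
theorem integral_eq_zero_of_upper_half_plane_bound {G : ℂ → ℂ} {A : ℝ} (hG : Differentiable ℂ G)
    (hA : ∀ z : ℂ, 0 ≤ z.im → ‖G z‖ ≤ A / (1 + ‖z‖ ^ 2)) : ∫ x : ℝ, G x = 0 := by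
  have hA0 : 0 ≤ A := by simpa using (norm_nonneg _).trans (hA 0 (by simp))
  have hint : Integrable fun x : ℝ => G x := by
    refine (integrable_inv_one_add_sq.const_mul A).mono'
      (hG.continuous.comp Complex.continuous_ofReal).aestronglyMeasurable
      (Eventually.of_forall fun x => ?_)
    simpa [div_eq_mul_inv] using hA x (by simp)
  have hlim := intervalIntegral_tendsto_integral hint tendsto_neg_atTop_atBot tendsto_id
  refine tendsto_nhds_unique hlim ?_
  refine squeeze_zero_norm' (a := fun R : ℝ => 4 * A / R) ?_
    (tendsto_const_nhds.div_atTop tendsto_id)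
  filter_upwards [eventually_gt_atTop 0] with R hR
  have hrect := Complex.integral_boundary_rect_eq_zero_of_differentiableOn G (-R : ℝ)
    ((R : ℂ) + R * I) hG.differentiableOn
  simp only [ofReal_re, ofReal_im, add_re, add_im, mul_re, mul_im, I_re, I_im, ofReal_zero,
    zero_mul, add_zero, mul_zero, mul_one, sub_zero, zero_add] at hrect
  have hb : ∀ z : ℂ, 0 ≤ z.im → R ≤ ‖z‖ → ‖G z‖ ≤ A / R ^ 2 := fun z hz hRz =>
    (hA z hz).trans (by gcongr; nlinarith)
  have h1 : ‖∫ x : ℝ in (-R)..R, G (x + R * I)‖ ≤ A / R ^ 2 * |R - -R| := by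
    refine intervalIntegral.norm_integral_le_of_norm_le_const fun x _ => hb _ (by simp [hR.le]) ?_
    have := Complex.abs_im_le_norm (x + R * I)
    simpa [abs_of_pos hR] using this
  have h2 : ‖∫ y : ℝ in (0 : ℝ)..R, G (R + y * I)‖ ≤ A / R ^ 2 * |R - 0| := by
    refine intervalIntegral.norm_integral_le_of_norm_le_const fun y hy => hb _ ?_ ?_
    · rw [Set.uIoc_of_le hR.le] at hy; simpa using hy.1.le
    have := Complex.abs_re_le_norm (R + y * I)
    simpa [abs_of_pos hR] using this
  have h3 : ‖∫ y : ℝ in (0 : ℝ)..R, G ((-R : ℝ) + y * I)‖ ≤ A / R ^ 2 * |R - 0| := by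
    refine intervalIntegral.norm_integral_le_of_norm_le_const fun y hy => hb _ ?_ ?_
    · rw [Set.uIoc_of_le hR.le] at hy; simpa using hy.1.le
    have := Complex.abs_re_le_norm ((-R : ℝ) + y * I)
    simpa [abs_of_pos hR] using this
  rw [show |R - -R| = 2 * R by rw [sub_neg_eq_add, ← two_mul, abs_of_pos (by positivity)]] at h1
  rw [sub_zero, abs_of_pos hR] at h2 h3
  have heq : ∫ x : ℝ in (-R)..R, G x = (∫ x : ℝ in (-R)..R, G (x + R * I))
      - I • (∫ y : ℝ in (0 : ℝ)..R, G (R + y * I))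
      + I • ∫ y : ℝ in (0 : ℝ)..R, G ((-R : ℝ) + y * I) := by
    linear_combination hrect
  simp only [id]
  rw [heq]
  refine (norm_add_le _ _).trans ((add_le_add_left (norm_sub_le _ _) _).trans ?_)
  rw [norm_smul, norm_smul, norm_I, one_mul, one_mul]
  have : A / R ^ 2 * (2 * R) + A / R ^ 2 * R + A / R ^ 2 * R = 4 * A / R := by
    field_simp; ring
  linarith

variable {F : ℂ → ℂ} {K τ : ℝ}

/-- The hypothesis `hK` is the only quantitative input of this section; it is later supplied by
`exists_norm_Psi_le`. -/
theorem integrable_of_strip_decay (hF : Differentiable ℂ F)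
    (hK : ∀ z : ℂ, ‖F z‖ ≤ K * Real.exp (τ * |z.im|) / (1 + ‖z‖ ^ 2)) :
    Integrable fun x : ℝ => F x := by
  refine (integrable_inv_one_add_sq.const_mul K).mono'
    (hF.continuous.comp Complex.continuous_ofReal).aestronglyMeasurable
    (Eventually.of_forall fun x => ?_)
  simpa [div_eq_mul_inv] using hK x

theorem memLp_two_of_strip_decay (hF : Differentiable ℂ F)
    (hK : ∀ z : ℂ, ‖F z‖ ≤ K * Real.exp (τ * |z.im|) / (1 + ‖z‖ ^ 2)) :
    MemLp (fun x : ℝ => F x) 2 := by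
  have hm : AEStronglyMeasurable (fun x : ℝ => F x) volume :=
    (hF.continuous.comp Complex.continuous_ofReal).aestronglyMeasurable
  rw [memLp_two_iff_integrable_sq_norm hm]
  have hK0 : 0 ≤ K := by simpa using (norm_nonneg _).trans (hK 0)
  refine ((integrable_of_strip_decay hF hK).norm.const_mul K).mono' (hm.norm.pow 2)
    (Eventually.of_forall fun x => ?_)
  have : ‖F x‖ ≤ K := by
    have h := hK x
    simp only [ofReal_im, abs_zero, mul_zero, Real.exp_zero, mul_one] at h
    exact h.trans (div_le_self hK0 (by nlinarith [norm_nonneg (x : ℂ)]))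
  rw [Real.norm_of_nonneg (by positivity), sq]
  exact mul_le_mul_of_nonneg_right this (norm_nonneg _)

theorem entireOfExpType_of_strip_decay (hF : Differentiable ℂ F) (hτ : 0 ≤ τ)
    (hK : ∀ z : ℂ, ‖F z‖ ≤ K * Real.exp (τ * |z.im|) / (1 + ‖z‖ ^ 2)) :
    EntireOfExpType F τ := by
  have hK0 : 0 ≤ K := by simpa using (norm_nonneg _).trans (hK 0)
  refine ⟨hF, K, fun z => (hK z).trans
    ((div_le_self (by positivity) (by nlinarith [norm_nonneg z])).trans ?_)⟩
  gcongr
  exact Complex.abs_im_le_norm z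

theorem norm_invFourier_le
    (hK : ∀ z : ℂ, ‖F z‖ ≤ K * Real.exp (τ * |z.im|) / (1 + ‖z‖ ^ 2)) (t : ℝ) :
    ‖invFourier F t‖ ≤ K / 2 := by
  have h : ‖∫ x : ℝ, F x * Complex.exp (Complex.I * t * x)‖ ≤ ∫ x : ℝ, K * (1 + x ^ 2)⁻¹ := by
    refine norm_integral_le_of_norm_le (integrable_inv_one_add_sq.const_mul K)
      (Eventually.of_forall fun x => ?_)
    rw [norm_mul, Complex.norm_exp]
    simpa [div_eq_mul_inv] using hK x
  rw [integral_const_mul, integral_univ_inv_one_add_sq] at h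
  rw [invFourier, norm_mul]
  calc _ ≤ ‖1 / (2 * (Real.pi : ℂ))‖ * (K * Real.pi) := by gcongr
    _ = K / 2 := by
      simp [abs_of_pos Real.pi_pos]
      field_simp

theorem continuous_invFourier (hF : Differentiable ℂ F)
    (hK : ∀ z : ℂ, ‖F z‖ ≤ K * Real.exp (τ * |z.im|) / (1 + ‖z‖ ^ 2)) :
    Continuous (invFourier F) := by
  have hc : Continuous fun x : ℝ => F x := hF.continuous.comp Complex.continuous_ofReal
  refine continuous_const.mul (continuous_of_dominated (bound := fun x : ℝ => ‖F x‖)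
    (fun t => (hc.mul (by fun_prop)).aestronglyMeasurable)
    (fun t => Eventually.of_forall fun x => ?_) (integrable_of_strip_decay hF hK).norm
    (Eventually.of_forall fun x => by fun_prop))
  rw [norm_mul, Complex.norm_exp]
  simp

/-- For `t ≥ τ` the modulus `e^{-t Im z}` of `e^{itz}` cancels `e^{τ Im z}` in the upper half plane.
The case `t ≤ -τ` follows by `z ↦ -z`. Allowing `|t| = τ` makes the support lie in an open interval.
-/
theorem invFourier_eq_zero (hF : Differentiable ℂ F)
    (hK : ∀ z : ℂ, ‖F z‖ ≤ K * Real.exp (τ * |z.im|) / (1 + ‖z‖ ^ 2)) {t : ℝ} (ht : τ ≤ |t|) :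
    invFourier F t = 0 := by
  have hK0 : 0 ≤ K := by simpa using (norm_nonneg _).trans (hK 0)
  rw [invFourier]
  rcases le_total 0 t with h0 | h0
  · rw [abs_of_nonneg h0] at ht
    rw [integral_eq_zero_of_upper_half_plane_bound (A := K)
      (G := fun z => F z * cexp (I * t * z)) (by fun_prop), mul_zero]
    intro z hz
    rw [norm_mul, Complex.norm_exp]
    have hre : (I * t * z).re = -(t * z.im) := by simp
    rw [hre]
    calc _ ≤ K * Real.exp (τ * |z.im|) / (1 + ‖z‖ ^ 2) * Real.exp (-(t * z.im)) := by
          gcongr; exact hK z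
      _ = K * Real.exp (τ * z.im - t * z.im) / (1 + ‖z‖ ^ 2) := by
          rw [abs_of_nonneg hz, sub_eq_add_neg, Real.exp_add]; ring
      _ ≤ K / (1 + ‖z‖ ^ 2) := by
          gcongr
          refine mul_le_of_le_one_right hK0 (Real.exp_le_one_iff.2 ?_)
          nlinarith
  · rw [abs_of_nonpos h0] at ht
    rw [← integral_neg_eq_self]
    have := integral_eq_zero_of_upper_half_plane_bound (A := K)
      (G := fun z => F (-z) * cexp (-(I * t * z))) (by fun_prop) (by
        intro z hz
        rw [norm_mul, Complex.norm_exp]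
        have hre : (-(I * t * z)).re = t * z.im := by simp
        rw [hre]
        have hz' := hK (-z)
        rw [neg_im, abs_neg, norm_neg] at hz'
        calc _ ≤ K * Real.exp (τ * |z.im|) / (1 + ‖z‖ ^ 2) * Real.exp (t * z.im) := by
              gcongr
          _ = K * Real.exp (τ * z.im + t * z.im) / (1 + ‖z‖ ^ 2) := by
              rw [abs_of_nonneg hz, Real.exp_add]; ring
          _ ≤ K / (1 + ‖z‖ ^ 2) := by
              gcongr
              refine mul_le_of_le_one_right hK0 (Real.exp_le_one_iff.2 ?_)
              nlinarith)
    simp only [ofReal_neg, mul_neg]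
    rw [this, mul_zero]

theorem support_invFourier_subset (hF : Differentiable ℂ F)
    (hK : ∀ z : ℂ, ‖F z‖ ≤ K * Real.exp (τ * |z.im|) / (1 + ‖z‖ ^ 2)) :
    Function.support (invFourier F) ⊆ Set.Ioo (-τ) τ := by
  intro t ht
  by_contra h
  refine ht (invFourier_eq_zero hF hK ?_)
  by_contra h'
  exact h (abs_lt.1 (not_le.1 h'))

open FourierTransform in
theorem invFourier_eq_fourierInv (t : ℝ) :
    invFourier F t = 1 / (2 * (Real.pi : ℂ)) *
      𝓕⁻ (fun x : ℝ => F x) (t / (2 * Real.pi)) := by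
  rw [invFourier, Real.fourierInv_eq']
  congr 1
  refine integral_congr_ae (Eventually.of_forall fun x => ?_)
  simp only [smul_eq_mul]
  rw [mul_comm]
  congr 2
  have : (Real.pi : ℂ) ≠ 0 := by exact_mod_cast Real.pi_ne_zero
  simp
  field_simp

open FourierTransform in
-- Fourier inversion. It holds at every point because `F` is continuous and integrable, and
-- `invFourier F`, continuous with compact support, is integrable too. The rest is the `2π`
-- rescaling to Mathlib's convention.
theorem integral_invFourier_mul_exp (hF : Differentiable ℂ F)
    (hK : ∀ z : ℂ, ‖F z‖ ≤ K * Real.exp (τ * |z.im|) / (1 + ‖z‖ ^ 2)) (x : ℝ) :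
    ∫ t in Set.Ioo (-τ) τ, invFourier F t * cexp (-(I * x * t)) = F x := by
  have hpi : (0 : ℝ) < 2 * Real.pi := by positivity
  have hsupp := support_invFourier_subset hF hK
  have hcont := continuous_invFourier hF hK
  rw [setIntegral_eq_integral_of_forall_compl_eq_zero (fun t ht => by
    rw [Function.notMem_support.1 (fun h => ht (hsupp h)), zero_mul])]
  have hint : Integrable (invFourier F) := by
    refine hcont.integrable_of_hasCompactSupport ?_
    exact HasCompactSupport.of_support_subset_isCompact isCompact_Icc
      (hsupp.trans Set.Ioo_subset_Icc_self)
  have hc : Continuous fun x : ℝ => F x := hF.continuous.comp Complex.continuous_ofReal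
  have heq : ∀ t : ℝ, 𝓕⁻ (fun x : ℝ => F x) t =
      2 * (Real.pi : ℂ) * invFourier F (t * (2 * Real.pi)) := by
    intro t
    rw [invFourier_eq_fourierInv, mul_div_cancel_right₀ _ hpi.ne']
    field_simp
  have hint' : Integrable (𝓕⁻ (fun x : ℝ => F x)) := by
    rw [funext heq]
    exact (hint.comp_mul_right' hpi.ne').const_mul _
  have hinv := congrFun (hc.fourier_fourierInv_eq (integrable_of_strip_decay hF hK)
    (by
      rw [show 𝓕 (fun x : ℝ => F x) = fun t => 𝓕⁻ (fun x : ℝ => F x) (-t) from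
        funext fun t => by rw [Real.fourierInv_eq_fourier_neg, neg_neg]]
      exact hint'.comp_neg)) x
  rw [Real.fourier_real_eq_integral_exp_smul] at hinv
  rw [← hinv]
  have hsub := Measure.integral_comp_mul_right
    (fun t : ℝ => invFourier F t * cexp (-(I * x * t))) (2 * Real.pi)
  rw [abs_of_pos (inv_pos.2 hpi), eq_inv_smul_iff₀ hpi.ne'] at hsub
  rw [← hsub, ← integral_smul]
  refine integral_congr_ae (Eventually.of_forall fun t => ?_)
  simp only [smul_eq_mul, heq, Complex.real_smul]
  have : (-2 * Real.pi * t * x : ℝ) * I = -(I * x * ((t * (2 * Real.pi) : ℝ) : ℂ)) := by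
    push_cast; ring
  rw [this]
  push_cast
  ring

end PaleyWiener

/-! ### Size and separation of the eigenvalues. -/

section Eigenvalues

/-- The real numbers `i λ_n = n (n⁴ + n² - 1)`. -/
def dispersion (n : ℤ) : ℝ := n * ((n : ℝ) ^ 4 + (n : ℝ) ^ 2 - 1)

theorem eigval_eq_dispersion (n : ℤ) : eigval n = -I * dispersion n := by
  simp only [eigval, dispersion]; push_cast; ring

theorem I_mul_eigval (n : ℤ) : I * eigval n = dispersion n := by
  rw [eigval_eq_dispersion, ← mul_assoc, mul_neg, I_mul_I, neg_neg, one_mul]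

theorem one_le_sq_of_int_ne_zero {n : ℤ} (hn : n ≠ 0) : (1 : ℝ) ≤ (n : ℝ) ^ 2 := by
  have : 0 < n ^ 2 := by positivity
  exact_mod_cast this

theorem one_le_abs_of_int_ne_zero {n : ℤ} (hn : n ≠ 0) : (1 : ℝ) ≤ |(n : ℝ)| := by
  exact_mod_cast Int.one_le_abs hn

theorem abs_pow_five_le_abs_dispersion {n : ℤ} (hn : n ≠ 0) :
    |(n : ℝ)| ^ 5 ≤ |dispersion n| := by
  have h := one_le_sq_of_int_ne_zero hn
  rw [dispersion, abs_mul, pow_succ' _ 4]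
  gcongr
  rw [Even.pow_abs (by decide)]
  exact (by linarith : (n : ℝ) ^ 4 ≤ (n : ℝ) ^ 4 + (n : ℝ) ^ 2 - 1).trans (le_abs_self _)

theorem sq_le_abs_dispersion {n : ℤ} (hn : n ≠ 0) : (n : ℝ) ^ 2 ≤ |dispersion n| := by
  refine le_trans ?_ (abs_pow_five_le_abs_dispersion hn)
  rw [← sq_abs]
  exact pow_le_pow_right₀ (one_le_abs_of_int_ne_zero hn) (by norm_num)

theorem abs_dispersion_pos {n : ℤ} (hn : n ≠ 0) : 0 < |dispersion n| :=
  (by linarith [one_le_sq_of_int_ne_zero hn] : (0 : ℝ) < (n : ℝ) ^ 2).trans_le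
    (sq_le_abs_dispersion hn)

/-- The exponent `6` is used because `m⁶ = (|m|³)²` matches the first index `|m|³` of `prodM`. -/
theorem abs_dispersion_le (n : ℤ) : |dispersion n| ≤ (n : ℝ) ^ 6 := by
  rcases eq_or_ne n 0 with rfl | hn
  · simp [dispersion]
  have h2 := one_le_sq_of_int_ne_zero hn
  have h1 := one_le_abs_of_int_ne_zero hn
  rw [dispersion, abs_mul,
    abs_of_nonneg (by nlinarith [sq_nonneg ((n : ℝ) ^ 2)] : 0 ≤ (n : ℝ) ^ 4 + (n : ℝ) ^ 2 - 1)]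
  rw [← Even.pow_abs (by decide : Even 4), ← Even.pow_abs (by decide : Even 6), ← sq_abs]
  rw [← sq_abs] at h2
  set a := |(n : ℝ)|
  -- Integrality matters: `a⁴ + a² - 1 ≤ a⁵` fails for real `a` slightly above `1`.
  have ha : a = 1 ∨ 2 ≤ a := by
    have : |n| = 1 ∨ 2 ≤ |n| := by have := Int.one_le_abs hn; omega
    rcases this with h | h
    · left; simp only [a]; exact_mod_cast h
    · right; simp only [a]; exact_mod_cast h
  rcases ha with h | h
  · rw [h]; norm_num
  · have : a ^ 6 - a * (a ^ 4 + a ^ 2 - 1) = a ^ 3 * (a ^ 2 * (a - 1) - 1) + a := by ring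
    have h3 : 0 ≤ a ^ 2 * (a - 1) - 1 := by nlinarith
    have h4 : 0 ≤ a ^ 3 * (a ^ 2 * (a - 1) - 1) := by positivity
    linarith

/-- With `s = n + m` and `d = n - m`, one has `(n⁵ - m⁵)/d = (5s⁴ + 10s²d² + d⁴)/16`, and `n² + nm +
m² ≥ 1` for distinct integers. This yields a gap of `|d|⁵/16`; its weakening to `d²/16` is enough
for summability. -/
theorem sq_sub_le_abs_dispersion_sub {m n : ℤ} (hmn : n ≠ m) :
    ((n : ℝ) - m) ^ 2 / 16 ≤ |dispersion n - dispersion m| := by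
  have hd : (1 : ℝ) ≤ |(n : ℝ) - m| := by
    exact_mod_cast one_le_abs_of_int_ne_zero (sub_ne_zero.2 hmn)
  have hq : (1 : ℝ) ≤ (n : ℝ) ^ 2 + n * m + (m : ℝ) ^ 2 := by
    have : 0 < n ^ 2 + n * m + m ^ 2 := by
      have : 0 < (n - m) ^ 2 := by have := sub_ne_zero.2 hmn; positivity
      nlinarith [sq_nonneg (n + m)]
    exact_mod_cast this
  have hfac : dispersion n - dispersion m = ((n : ℝ) - m) *
      ((5 * ((n : ℝ) + m) ^ 4 + 10 * ((n : ℝ) + m) ^ 2 * ((n : ℝ) - m) ^ 2 + ((n : ℝ) - m) ^ 4) / 16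
        + ((n : ℝ) ^ 2 + n * m + (m : ℝ) ^ 2 - 1)) := by
    simp only [dispersion]; ring
  have h4 : |(n : ℝ) - m| ≤ ((n : ℝ) - m) ^ 4 := by
    rw [← Even.pow_abs (by decide : Even 4)]
    exact le_self_pow₀ hd (by norm_num)
  have h5 : |(n : ℝ) - m| / 16 ≤
      |(5 * ((n : ℝ) + m) ^ 4 + 10 * ((n : ℝ) + m) ^ 2 * ((n : ℝ) - m) ^ 2 + ((n : ℝ) - m) ^ 4) / 16
        + ((n : ℝ) ^ 2 + n * m + (m : ℝ) ^ 2 - 1)| := by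
    refine le_trans ?_ (le_abs_self _)
    have : 0 ≤ 5 * ((n : ℝ) + m) ^ 4 + 10 * ((n : ℝ) + m) ^ 2 * ((n : ℝ) - m) ^ 2 := by positivity
    linarith
  calc ((n : ℝ) - m) ^ 2 / 16 = |(n : ℝ) - m| * (|(n : ℝ) - m| / 16) := by rw [← sq_abs]; ring
    _ ≤ _ := by rw [hfac, abs_mul]; gcongr

theorem abs_dispersion_sub_pos {m n : ℤ} (hmn : n ≠ m) : 0 < |dispersion n - dispersion m| := by
  refine lt_of_lt_of_le ?_ (sq_sub_le_abs_dispersion_sub hmn)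
  have : (n : ℝ) - m ≠ 0 := by exact_mod_cast sub_ne_zero.2 hmn
  positivity

end Eigenvalues

/-! ### The interpolating product `P_m`. -/

section ProductP

variable {m n : ℤ}

/-- In this form both factors are visibly `1` plus a summable term. -/
theorem factorP_eq (hn : n ≠ 0) (hmn : n ≠ m) (z : ℂ) :
    factorP m n z = (1 - z / dispersion n) *
      (1 + ((dispersion m / (dispersion n - dispersion m) : ℝ) : ℂ)) := by
  have h0 : (dispersion n : ℂ) ≠ 0 := by exact_mod_cast abs_pos.1 (abs_dispersion_pos hn)
  have h1 : (dispersion n : ℂ) - dispersion m ≠ 0 := by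
    exact_mod_cast abs_pos.1 (abs_dispersion_sub_pos hmn)
  have hI := I_ne_zero
  rw [factorP, eigval_eq_dispersion, eigval_eq_dispersion]
  push_cast
  congr 1
  · field_simp
    ring
  · rw [← mul_sub, mul_div_mul_left _ _ (neg_ne_zero.2 hI)]
    field_simp
    ring

theorem differentiable_factorP (m n : ℤ) : Differentiable ℂ (factorP m n) := by
  unfold factorP
  fun_prop

theorem abs_dispersion_ratio_le (hmn : n ≠ m) :
    |dispersion m / (dispersion n - dispersion m)| ≤
      16 * (m : ℝ) ^ 6 * (1 / ((n : ℝ) - m) ^ 2) := by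
  have : (n : ℝ) - m ≠ 0 := by exact_mod_cast sub_ne_zero.2 hmn
  rw [abs_div]
  calc _ ≤ (m : ℝ) ^ 6 / (((n : ℝ) - m) ^ 2 / 16) := by
        gcongr
        · exact abs_dispersion_le m
        · exact sq_sub_le_abs_dispersion_sub hmn
    _ = _ := by field_simp

theorem summable_one_div_int_sub_sq (m : ℤ) : Summable fun n : ℤ => 1 / ((n : ℝ) - m) ^ 2 := by
  have := (Equiv.subRight m).summable_iff.2 (Real.summable_one_div_int_pow.2 one_lt_two)
  simpa [Function.comp_def] using this

/-- Translation invariance keeps the bound on `P_m` uniform in `m` apart from the factor `m⁶`. The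
term `n = m` is `1/0 = 0`. -/
theorem tsum_one_div_int_sub_sq (m : ℤ) :
    ∑' n : ℤ, 1 / ((n : ℝ) - m) ^ 2 = ∑' n : ℤ, 1 / (n : ℝ) ^ 2 := by
  have := (Equiv.subRight m).tsum_eq fun n : ℤ => 1 / (n : ℝ) ^ 2
  simpa using this

theorem factorP_sub_one_bound (m : ℤ) (R : ℝ) :
    ∃ u : {n : ℤ // n ≠ 0 ∧ n ≠ m} → ℝ, Summable u ∧
      ∀ n : {n : ℤ // n ≠ 0 ∧ n ≠ m}, ∀ z : ℂ, ‖z‖ ≤ R → ‖factorP m n z - 1‖ ≤ u n := by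
  set A : ℝ := 16 * (m : ℝ) ^ 6
  have hA0 : 0 ≤ A := by positivity
  refine ⟨fun n => A * (1 / ((n : ℤ) - m : ℝ) ^ 2) + R * (1 + A) * (1 / ((n : ℤ) : ℝ) ^ 2),
    (((summable_one_div_int_sub_sq m).mul_left A).add
      ((Real.summable_one_div_int_pow.2 one_lt_two).mul_left (R * (1 + A)))).subtype _, ?_⟩
  rintro ⟨n, hn, hmn⟩ z hz
  have hR : 0 ≤ R := (norm_nonneg z).trans hz
  have ha := abs_dispersion_ratio_le hmn
  rw [factorP_eq hn hmn]
  set a := dispersion m / (dispersion n - dispersion m)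
  have haA : |a| ≤ A := by
    refine ha.trans (mul_le_of_le_one_right hA0 ?_)
    have : (1 : ℝ) ≤ ((n : ℝ) - m) ^ 2 := by
      exact_mod_cast one_le_sq_of_int_ne_zero (sub_ne_zero.2 hmn)
    exact div_le_one_of_le₀ this (by positivity)
  have heq : (1 - z / dispersion n) * (1 + (a : ℂ)) - 1
      = a - z / dispersion n * (1 + (a : ℂ)) := by ring
  rw [heq]
  refine (norm_sub_le _ _).trans (add_le_add (by simpa using ha) ?_)
  have h1 : ‖z / dispersion n‖ ≤ R * (1 / (n : ℝ) ^ 2) := by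
    have := one_le_sq_of_int_ne_zero hn
    rw [norm_div, norm_real, Real.norm_eq_abs, mul_one_div]
    gcongr
    exact sq_le_abs_dispersion hn
  have h2 : ‖1 + (a : ℂ)‖ ≤ 1 + A := (norm_add_le _ _).trans (by simpa using haA)
  rw [norm_mul]
  calc _ ≤ R * (1 / (n : ℝ) ^ 2) * (1 + A) := by gcongr
    _ = _ := by ring

theorem multipliable_factorP (m : ℤ) (z : ℂ) :
    Multipliable fun n : {n : ℤ // n ≠ 0 ∧ n ≠ m} => factorP m n z :=
  multipliable_of_summable_bound (f := fun (n : {n : ℤ // n ≠ 0 ∧ n ≠ m}) z => factorP m n z)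
    (factorP_sub_one_bound m) z

theorem differentiable_prodP (m : ℤ) : Differentiable ℂ (prodP m) :=
  differentiable_tprod (f := fun (n : {n : ℤ // n ≠ 0 ∧ n ≠ m}) z => factorP m n z)
    (fun n => differentiable_factorP m n) (factorP_sub_one_bound m)

/-- With `v⁴ = |z|/|n|⁵`, use `1 + v⁴ ≤ (1 + v)⁴ ≤ e^{4v}`. The power `1/4` exceeds `1/5`, so that
`∑ |n|^{-5/4}` converges, and is below `1/2`, so that the decay of `prodM` wins. -/
theorem norm_factorP_le (hn : n ≠ 0) (hmn : n ≠ m) (z : ℂ) :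
    ‖factorP m n z‖ ≤ Real.exp (4 * ‖z‖ ^ (1 / 4 : ℝ) * |(n : ℝ)| ^ (-(5 / 4) : ℝ) +
      16 * (m : ℝ) ^ 6 * (1 / ((n : ℝ) - m) ^ 2)) := by
  rw [factorP_eq hn hmn, norm_mul, Real.exp_add]
  have hn0 : 0 < |(n : ℝ)| := by linarith [one_le_abs_of_int_ne_zero hn]
  gcongr
  · set v := ‖z‖ ^ (1 / 4 : ℝ) * |(n : ℝ)| ^ (-(5 / 4) : ℝ)
    have hv0 : 0 ≤ v := by positivity
    have hv : v ^ 4 = ‖z‖ / |(n : ℝ)| ^ 5 := by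
      have h1 : (‖z‖ ^ (1 / 4 : ℝ)) ^ 4 = ‖z‖ := by
        rw [← Real.rpow_natCast, ← Real.rpow_mul (norm_nonneg z)]; norm_num
      have h2 : (|(n : ℝ)| ^ (-(5 / 4) : ℝ)) ^ 4 = (|(n : ℝ)| ^ 5)⁻¹ := by
        rw [← Real.rpow_natCast, ← Real.rpow_mul hn0.le, ← Real.rpow_natCast, ← Real.rpow_neg hn0.le]
        norm_num
      rw [mul_pow, h1, h2, div_eq_mul_inv]
    have h1 : ‖1 - z / dispersion n‖ ≤ 1 + v ^ 4 := by
      refine (norm_sub_le _ _).trans ?_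
      rw [norm_one, norm_div, norm_real, Real.norm_eq_abs, hv]
      gcongr
      exact abs_pow_five_le_abs_dispersion hn
    calc _ ≤ 1 + v ^ 4 := h1
      _ ≤ (v + 1) ^ 4 := by
        have : (v + 1) ^ 4 = 1 + v ^ 4 + (4 * v + 6 * v ^ 2 + 4 * v ^ 3) := by ring
        rw [this]; exact le_add_of_nonneg_right (by positivity)
      _ ≤ Real.exp v ^ 4 := by gcongr; exact Real.add_one_le_exp v
      _ = _ := by rw [← Real.exp_nat_mul]; congr 1; push_cast; ring
  · refine (norm_add_le _ _).trans ?_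
    rw [norm_one, norm_real, Real.norm_eq_abs, add_comm]
    exact (Real.add_one_le_exp _).trans (Real.exp_le_exp.2 (abs_dispersion_ratio_le hmn))

theorem norm_prodP_le (m : ℤ) (z : ℂ) :
    ‖prodP m z‖ ≤ Real.exp (4 * ‖z‖ ^ (1 / 4 : ℝ) * ∑' n : ℤ, |(n : ℝ)| ^ (-(5 / 4) : ℝ) +
      16 * (m : ℝ) ^ 6 * ∑' n : ℤ, 1 / (n : ℝ) ^ 2) := by
  have hs1 : Summable fun n : ℤ =>
      4 * ‖z‖ ^ (1 / 4 : ℝ) * |(n : ℝ)| ^ (-(5 / 4) : ℝ) :=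
    (Real.summable_abs_int_rpow (by norm_num)).mul_left _
  have hs2 := (summable_one_div_int_sub_sq m).mul_left (16 * (m : ℝ) ^ 6)
  have hs := hs1.add hs2
  refine (norm_tprod_le_exp_tsum (multipliable_factorP m z) (hs.subtype _)
    fun n => norm_factorP_le n.2.1 n.2.2 z).trans (Real.exp_le_exp.2 ?_)
  refine (Summable.tsum_subtype_le _ _ (fun n => by positivity) hs).trans (le_of_eq ?_)
  rw [hs1.tsum_add hs2, tsum_mul_left, tsum_mul_left, tsum_one_div_int_sub_sq]

theorem prodP_dispersion_self (m : ℤ) : prodP m (dispersion m) = 1 := by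
  rw [prodP]
  convert tprod_one with n
  rw [factorP_eq n.2.1 n.2.2]
  have h0 : (dispersion n : ℂ) ≠ 0 := by exact_mod_cast abs_pos.1 (abs_dispersion_pos n.2.1)
  have h1 : (dispersion n : ℂ) - dispersion m ≠ 0 := by
    exact_mod_cast abs_pos.1 (abs_dispersion_sub_pos n.2.2)
  push_cast
  field_simp
  ring

theorem prodP_dispersion_of_ne (hn : n ≠ 0) (hmn : n ≠ m) : prodP m (dispersion n) = 0 := by
  refine tprod_of_exists_eq_zero ⟨⟨n, hn, hmn⟩, ?_⟩
  rw [factorP_eq hn hmn, div_self, sub_self, zero_mul]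
  exact_mod_cast abs_pos.1 (abs_dispersion_pos hn)

end ProductP

/-! ### The decaying multiplier `M_k`. -/

section ProductM

variable {k : ℕ}

theorem one_le_of_cube_le (hk : 1 ≤ k) {n : ℕ} (hn : k ^ 3 ≤ n) : (1 : ℝ) ≤ n := by
  exact_mod_cast (Nat.one_le_pow _ _ hk).trans hn

theorem differentiable_factorM (n : ℕ) : Differentiable ℂ (factorM n) :=
  differentiable_csinc.comp (differentiable_id.div_const _)

theorem factorM_sub_one_bound (hk : 1 ≤ k) (R : ℝ) :
    ∃ u : {n : ℕ // k ^ 3 ≤ n} → ℝ, Summable u ∧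
      ∀ n : {n : ℕ // k ^ 3 ≤ n}, ∀ z : ℂ, ‖z‖ ≤ R → ‖factorM n z - 1‖ ≤ u n := by
  refine ⟨fun n => R * Real.exp R * (1 / ((n : ℕ) : ℝ) ^ 2),
    ((Real.summable_one_div_nat_pow.2 one_lt_two).mul_left _).subtype _, ?_⟩
  rintro ⟨n, hn⟩ z hz
  have hn1 := one_le_of_cube_le hk hn
  have hR : 0 ≤ R := (norm_nonneg z).trans hz
  refine (norm_csinc_sub_one_le _).trans ?_
  have h1 : ‖z / (n : ℂ) ^ 2‖ ≤ R * (1 / (n : ℝ) ^ 2) := by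
    rw [norm_div, norm_pow, norm_natCast, mul_one_div]
    gcongr
  have h2 : R * (1 / (n : ℝ) ^ 2) ≤ R :=
    mul_le_of_le_one_right hR (div_le_one_of_le₀ (by nlinarith) (by positivity))
  calc _ ≤ R * (1 / (n : ℝ) ^ 2) * Real.exp R := by
        gcongr
        exact h1.trans h2
    _ = _ := by ring

theorem multipliable_factorM (hk : 1 ≤ k) (z : ℂ) :
    Multipliable fun n : {n : ℕ // k ^ 3 ≤ n} => factorM n z :=
  multipliable_of_summable_bound (f := fun (n : {n : ℕ // k ^ 3 ≤ n}) z => factorM n z)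
    (factorM_sub_one_bound hk) z

theorem differentiable_prodM (hk : 1 ≤ k) : Differentiable ℂ (prodM k) :=
  differentiable_tprod (f := fun (n : {n : ℕ // k ^ 3 ≤ n}) z => factorM n z)
    (fun n => differentiable_factorM n) (factorM_sub_one_bound hk)

theorem abs_im_div_natCast_sq (z : ℂ) (n : ℕ) :
    |(z / (n : ℂ) ^ 2).im| = |z.im| * (1 / (n : ℝ) ^ 2) := by
  rw [show (n : ℂ) ^ 2 = (((n : ℝ) ^ 2 : ℝ) : ℂ) by push_cast; rfl, div_ofReal_im, abs_div,
    abs_of_nonneg (by positivity : (0 : ℝ) ≤ (n : ℝ) ^ 2), mul_one_div]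

theorem summable_mul_one_div_nat_sq (c : ℝ) : Summable fun n : ℕ => c * (1 / (n : ℝ) ^ 2) :=
  (Real.summable_one_div_nat_pow.2 one_lt_two).mul_left c

theorem tsum_subtype_mul_one_div_nat_sq_le {c : ℝ} (hc : 0 ≤ c) (K : ℕ) :
    ∑' n : {n : ℕ // K ≤ n}, c * (1 / ((n : ℕ) : ℝ) ^ 2) ≤
      c * ∑' n : ℕ, 1 / (n : ℝ) ^ 2 := by
  rw [← tsum_mul_left]
  exact Summable.tsum_subtype_le (fun n : ℕ => c * (1 / (n : ℝ) ^ 2)) {n : ℕ | K ≤ n}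
    (fun n => by positivity) (summable_mul_one_div_nat_sq c)

theorem norm_prodM_le (hk : 1 ≤ k) (z : ℂ) :
    ‖prodM k z‖ ≤ Real.exp (|z.im| * ∑' n : ℕ, 1 / (n : ℝ) ^ 2) := by
  refine (norm_tprod_le_exp_tsum (multipliable_factorM hk z)
    ((summable_mul_one_div_nat_sq |z.im|).subtype {n | k ^ 3 ≤ n}) fun n => ?_).trans
    (Real.exp_le_exp.2 (tsum_subtype_mul_one_div_nat_sq_le (abs_nonneg _) _))
  refine (norm_csinc_le_exp_abs_im _).trans (Real.exp_le_exp.2 (le_of_eq ?_))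
  exact abs_im_div_natCast_sq z n

/-- For `k³ ≤ n ≤ √|z|/2` the argument satisfies `|z/n²| ≥ 4 > e`, so `|sin w / w|` gains a factor
`e⁻¹` over the bound `e^{|Im w|}`. There are at least `√|z|/2 - k³` such `n`. -/
theorem norm_prodM_le_decay (hk : 1 ≤ k) (z : ℂ) :
    ‖prodM k z‖ ≤
      Real.exp (|z.im| * (∑' n : ℕ, 1 / (n : ℝ) ^ 2) + (k ^ 3 - √‖z‖ / 2)) := by
  classical
  set L : ℕ := ⌊√‖z‖ / 2⌋₊
  set T : Finset {n : ℕ // k ^ 3 ≤ n} := (Finset.Icc (k ^ 3) L).subtype (fun n => k ^ 3 ≤ n)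
    with hT
  have hsupp : ∀ n ∉ T, (if n ∈ T then (1 : ℝ) else 0) = 0 := fun n hn => if_neg hn
  have hs1 : Summable fun n : {n : ℕ // k ^ 3 ≤ n} => |z.im| * (1 / ((n : ℕ) : ℝ) ^ 2) :=
    (summable_mul_one_div_nat_sq |z.im|).subtype {n | k ^ 3 ≤ n}
  have hs2 : HasSum (fun n => if n ∈ T then (1 : ℝ) else 0) (∑ n ∈ T, if n ∈ T then 1 else 0) :=
    hasSum_sum_of_ne_finset_zero hsupp
  refine (norm_tprod_le_exp_tsum (multipliable_factorM hk z) (hs1.sub hs2.summable)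
    fun n => ?_).trans (Real.exp_le_exp.2 ?_)
  · split_ifs with hn
    · have hn1 := one_le_of_cube_le hk n.2
      have hnL : (n : ℕ) ≤ L := (Finset.mem_Icc.1 (Finset.mem_subtype.1 hn)).2
      have h2 : 2 * ((n : ℕ) : ℝ) ≤ √‖z‖ := by
        have := (Nat.le_floor_iff (by positivity)).1 hnL
        linarith
      have h3 : 4 * ((n : ℕ) : ℝ) ^ 2 ≤ ‖z‖ := by
        rw [← Real.sq_sqrt (norm_nonneg z)]
        nlinarith
      have hw : 4 ≤ ‖z / ((n : ℕ) : ℂ) ^ 2‖ := by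
        rw [norm_div, norm_pow, norm_natCast, le_div_iff₀ (by positivity)]
        exact h3
      refine (norm_csinc_le_div _ (norm_pos_iff.1 (by linarith))).trans ?_
      rw [abs_im_div_natCast_sq, Real.exp_sub]
      gcongr
      linarith [Real.exp_one_lt_d9]
    · rw [sub_zero]
      refine (norm_csinc_le_exp_abs_im _).trans (Real.exp_le_exp.2 (le_of_eq ?_))
      exact abs_im_div_natCast_sq z n
  · rw [hs1.tsum_sub hs2.summable, hs2.tsum_eq]
    have h1 := tsum_subtype_mul_one_div_nat_sq_le (abs_nonneg z.im) (k ^ 3)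
    have hcard : √‖z‖ / 2 - (k : ℝ) ^ 3 ≤ ∑ n ∈ T, (if n ∈ T then (1 : ℝ) else 0) := by
      rw [Finset.sum_ite_mem, Finset.inter_self, Finset.sum_const, nsmul_eq_mul, mul_one, hT,
        Finset.card_subtype, Finset.filter_true_of_mem fun n hn => (Finset.mem_Icc.1 hn).1,
        Nat.card_Icc]
      have h4 : √‖z‖ / 2 < L + 1 := Nat.lt_floor_add_one _
      -- Truncated subtraction also covers the case of no such index, where `L + 1 ≤ k³`.
      have h5 : ((L + 1 : ℕ) : ℝ) ≤ ((L + 1 - k ^ 3 : ℕ) : ℝ) + ((k ^ 3 : ℕ) : ℝ) := by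
        exact_mod_cast (by omega : L + 1 ≤ L + 1 - k ^ 3 + k ^ 3)
      push_cast at h5
      linarith
    linarith

theorem natAbs_cast_cube_sq (m : ℤ) : ((m.natAbs : ℝ) ^ 3) ^ 2 = (m : ℝ) ^ 6 := by
  rw [← pow_mul, Nat.cast_natAbs, Int.cast_abs, Even.pow_abs (by decide)]

/-- For `n ≥ |m|³` the argument satisfies `|μ_m|/n² ≤ m⁶/n² ≤ 1`, so `exp_neg_abs_le_norm_csinc`
applies to every factor. -/
theorem exp_neg_le_norm_prodM {m : ℤ} (hm : m ≠ 0) :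
    Real.exp (-((m : ℝ) ^ 6 * ∑' n : ℕ, 1 / (n : ℝ) ^ 2)) ≤
      ‖prodM m.natAbs (dispersion m)‖ := by
  have hk : 1 ≤ m.natAbs := Int.natAbs_pos.2 hm
  have hs := (summable_mul_one_div_nat_sq ((m : ℝ) ^ 6)).subtype {n | m.natAbs ^ 3 ≤ n}
  refine le_trans (Real.exp_le_exp.2 ?_)
    (exp_tsum_le_norm_tprod (multipliable_factorM hk (dispersion m)) hs.neg fun n => ?_)
  · rw [tsum_neg, neg_le_neg_iff]
    exact tsum_subtype_mul_one_div_nat_sq_le (by positivity) _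
  · have hn1 := one_le_of_cube_le hk n.2
    have hn2 : (m : ℝ) ^ 6 ≤ ((n : ℕ) : ℝ) ^ 2 := by
      rw [← natAbs_cast_cube_sq]
      gcongr
      exact_mod_cast n.2
    have habs : |dispersion m / ((n : ℕ) : ℝ) ^ 2| ≤ (m : ℝ) ^ 6 * (1 / ((n : ℕ) : ℝ) ^ 2) := by
      rw [abs_div, abs_of_nonneg (by positivity : (0 : ℝ) ≤ ((n : ℕ) : ℝ) ^ 2), mul_one_div]
      gcongr
      exact abs_dispersion_le m
    have h1 : (m : ℝ) ^ 6 * (1 / ((n : ℕ) : ℝ) ^ 2) ≤ 1 := by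
      rw [mul_one_div]
      exact div_le_one_of_le₀ hn2 (by positivity)
    have := exp_neg_abs_le_norm_csinc _ (habs.trans h1)
    push_cast at this
    exact (Real.exp_le_exp.2 (neg_le_neg habs)).trans this

theorem prodM_dispersion_ne_zero {m : ℤ} (hm : m ≠ 0) : prodM m.natAbs (dispersion m) ≠ 0 :=
  norm_pos_iff.1 ((Real.exp_pos _).trans_le (exp_neg_le_norm_prodM hm))

end ProductM

/-! ### The function `Ψ_m`: interpolation and growth. -/

section PsiBounds

theorem differentiable_Psi (N : ℕ) (δ : ℝ) {m : ℤ} (hm : m ≠ 0) : Differentiable ℂ (Psi N δ m) := by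
  have h1 := differentiable_prodP m
  have h2 := differentiable_prodM (Int.natAbs_pos.2 hm)
  have h3 := differentiable_csinc
  unfold Psi
  fun_prop

theorem Psi_dispersion (N : ℕ) (δ : ℝ) {m n : ℤ} (hm : m ≠ 0) (hn : n ≠ 0) :
    Psi N δ m (dispersion n) = if m = n then 1 else 0 := by
  rw [Psi, I_mul_eigval]
  split_ifs with h
  · subst h
    rw [prodP_dispersion_self, div_self (prodM_dispersion_ne_zero hm), sub_self, mul_zero,
      csinc_zero, one_pow, one_mul, one_mul]
  · rw [prodP_dispersion_of_ne hn (Ne.symm h), zero_mul, zero_mul]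

theorem norm_csinc_shift_le {δ : ℝ} (hδ : 0 < δ) (z : ℂ) (a : ℝ) :
    ‖csinc (δ * (z - a))‖ ≤ Real.exp (δ * |z.im|) := by
  refine (norm_csinc_le_exp_abs_im _).trans (le_of_eq ?_)
  simp [abs_mul, abs_of_pos hδ]

/-- The weight is measured on the scale `|z|^{1/4}` of the growth of `P_m`, so that both are
absorbed together. -/
theorem one_add_sq_le_exp (r : ℝ) (hr : 0 ≤ r) : 1 + r ^ 2 ≤ Real.exp (8 * r ^ (1 / 4 : ℝ)) := by
  set u := r ^ (1 / 4 : ℝ)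
  have hu : 0 ≤ u := by positivity
  have h1 : u ^ 4 = r := by
    simp only [u]
    rw [← Real.rpow_natCast, ← Real.rpow_mul hr]; norm_num
  calc 1 + r ^ 2 = 1 ^ 8 + u ^ 8 := by rw [← h1]; ring
    _ ≤ (1 + u) ^ 8 := pow_add_pow_le zero_le_one hu (by norm_num)
    _ ≤ Real.exp u ^ 8 := by rw [add_comm]; gcongr; exact Real.add_one_le_exp u
    _ = _ := by rw [← Real.exp_nat_mul]; norm_num

theorem exists_norm_Psi_le (N : ℕ) (hN : 1 ≤ N) (δ : ℝ) (hδ : 0 < δ) :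
    ∃ C b : ℝ, 0 < C ∧ 0 < b ∧ ∀ m : ℤ, m ≠ 0 → ∀ z : ℂ,
      ‖Psi N δ m z‖ ≤ C * Real.exp (b * (m : ℝ) ^ 6) *
        Real.exp ((N * (∑' n : ℕ, 1 / (n : ℝ) ^ 2) + δ) * |z.im|) / (1 + ‖z‖ ^ 2) := by
  set s : ℝ := ∑' n : ℕ, 1 / (n : ℝ) ^ 2
  set S₁ : ℝ := ∑' n : ℤ, |(n : ℝ)| ^ (-(5 / 4) : ℝ)
  set S₂ : ℝ := ∑' n : ℤ, 1 / (n : ℝ) ^ 2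
  have hs : 0 ≤ s := tsum_nonneg fun n => by positivity
  have hS₂ : 0 ≤ S₂ := tsum_nonneg fun n => by positivity
  -- In `b`, `16 S₂` comes from `P_m`, `1` from `|m|³ ≤ m⁶` in the decay of `M`, and `N s` from the
  -- normalising denominator.
  refine ⟨Real.exp ((4 * S₁ + 8) ^ 2 / 2), 16 * S₂ + 1 + N * s, Real.exp_pos _, by positivity,
    fun m hm z => ?_⟩
  have hk : 1 ≤ m.natAbs := Int.natAbs_pos.2 hm
  -- A single copy of `M` provides the decay; the other copies are only bounded by their exponential
  -- type.
  obtain ⟨N, rfl⟩ : ∃ M, N = M + 1 := ⟨N - 1, by omega⟩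
  set u := ‖z‖ ^ (1 / 4 : ℝ) with hu
  have hsqrt : √‖z‖ = u ^ 2 := by
    rw [hu, Real.sqrt_eq_rpow, ← Real.rpow_natCast, ← Real.rpow_mul (norm_nonneg z)]; norm_num
  have hP := norm_prodP_le m z
  have hM := norm_prodM_le hk z
  have hM' := norm_prodM_le_decay hk z
  have hμ := exp_neg_le_norm_prodM hm
  have hcube : (m.natAbs : ℝ) ^ 3 ≤ (m : ℝ) ^ 6 := by
    rw [← natAbs_cast_cube_sq]
    exact le_self_pow₀ (one_le_pow₀ (by exact_mod_cast hk)) (by norm_num)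
  have hMN : ‖prodM m.natAbs z‖ ^ (N + 1) ≤
      Real.exp ((N + 1) * (|z.im| * s) + ((m : ℝ) ^ 6 - u ^ 2 / 2)) := by
    rw [pow_succ]
    calc _ ≤ Real.exp (|z.im| * s) ^ N * Real.exp (|z.im| * s + (m.natAbs ^ 3 - √‖z‖ / 2)) := by
          gcongr
      _ = Real.exp ((N + 1) * (|z.im| * s) + (m.natAbs ^ 3 - u ^ 2 / 2)) := by
          rw [← Real.exp_nat_mul, ← Real.exp_add, hsqrt]; congr 1; ring
      _ ≤ _ := by gcongr
  have hμN : Real.exp (-((N + 1) * ((m : ℝ) ^ 6 * s))) ≤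
      ‖prodM m.natAbs (dispersion m)‖ ^ (N + 1) := by
    calc _ = Real.exp (-((m : ℝ) ^ 6 * s)) ^ (N + 1) := by
          rw [← Real.exp_nat_mul]; congr 1; push_cast; ring
      _ ≤ _ := by gcongr
  rw [le_div_iff₀ (by positivity), Psi, I_mul_eigval, norm_mul, norm_mul, norm_pow, norm_div,
    div_pow]
  calc _ ≤ Real.exp (4 * u * S₁ + 16 * (m : ℝ) ^ 6 * S₂) *
        (Real.exp ((N + 1) * (|z.im| * s) + ((m : ℝ) ^ 6 - u ^ 2 / 2)) /
          Real.exp (-((N + 1) * ((m : ℝ) ^ 6 * s)))) * Real.exp (δ * |z.im|) *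
        Real.exp (8 * u) := by
        gcongr
        · exact norm_csinc_shift_le hδ z _
        · exact one_add_sq_le_exp _ (norm_nonneg z)
    _ ≤ _ := by
        rw [← Real.exp_sub, ← Real.exp_add, ← Real.exp_add, ← Real.exp_add, ← Real.exp_add,
          ← Real.exp_add, Real.exp_le_exp]
        push_cast
        -- Completing the square: `(4S₁ + 8)u - u²/2 ≤ (4S₁ + 8)²/2`.
        nlinarith [sq_nonneg (4 * S₁ + 8 - u)]

end PsiBounds

/-! ### Conclusion: the biorthogonal family. -/

theorem exp_neg_eigval_mul (n : ℤ) (t : ℝ) :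
    cexp (-eigval n * t) = cexp (I * dispersion n * t) := by
  rw [eigval_eq_dispersion]; ring_nf

theorem eLpNorm_two_Ioo_le {f : ℝ → ℂ} {B T : ℝ} (hT : 0 ≤ T) (hf : ∀ t, ‖f t‖ ≤ B) :
    eLpNorm f 2 (volume.restrict (Set.Ioo (-T / 2) (T / 2))) ≤ ENNReal.ofReal (√T * B) := by
  refine (eLpNorm_le_of_ae_bound (Eventually.of_forall hf)).trans (le_of_eq ?_)
  rw [Measure.restrict_apply_univ, Real.volume_Ioo, ENNReal.ofReal_mul (by positivity),
    Real.sqrt_eq_rpow, ENNReal.ofReal_rpow_of_nonneg (by linarith) (by norm_num)]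
  norm_num
  congr 2
  ring_nf

end

open Complex Filter in
theorem theorem2p1 (N : ℕ) (hN : 1 ≤ N) (δ : ℝ) (hδ : 0 < δ) :
    ∃ T₁ : ℝ, 0 < T₁ ∧ ∃ C b : ℝ, 0 < C ∧ 0 < b ∧
      ∃ Θ : {m : ℤ // m ≠ 0} → ℝ → ℂ,
        -- biorthogonality in `L²(-T₁/2, T₁/2)` and the norm bound
        BiorthogonalL2 T₁ Θ
          (fun (n : {n : ℤ // n ≠ 0}) (t : ℝ) => Complex.exp (-eigval n * t)) ∧
        (∀ m : {m : ℤ // m ≠ 0},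
          eLpNorm (Θ m) 2 (volume.restrict (Set.Ioo (-T₁ / 2) (T₁ / 2))) ≤
            ENNReal.ofReal (C * Real.exp (b * ((m : ℤ) : ℝ) ^ 6))) ∧
        -- `Θ_m` is the inverse Fourier transform of the well-defined entire function `Ψ_m`
        ∀ m : {m : ℤ // m ≠ 0},
          (∀ z : ℂ, Multipliable
            (fun n : {n : ℤ // n ≠ 0 ∧ n ≠ (m : ℤ)} => factorP m n z)) ∧
          (∀ z : ℂ, Multipliable
            (fun n : {n : ℕ // (m : ℤ).natAbs ^ 3 ≤ n} => factorM n z)) ∧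
          prodM (m : ℤ).natAbs (Complex.I * eigval m) ≠ 0 ∧
          EntireOfExpType (Psi N δ m) (T₁ / 2) ∧
          (∀ n : {n : ℤ // n ≠ 0},
            Psi N δ m (Complex.I * eigval n) = if m = n then 1 else 0) ∧
          Integrable (fun x : ℝ => Psi N δ m x) ∧
          MemLp (fun x : ℝ => Psi N δ m x) 2 ∧
          Θ m = invFourier (Psi N δ m) ∧
          Function.support (Θ m) ⊆ Set.Ioo (-T₁ / 2) (T₁ / 2) := by
  obtain ⟨C, b, hC, hb, hΨ⟩ := exists_norm_Psi_le N hN δ hδ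
  set τ : ℝ := N * (∑' n : ℕ, 1 / (n : ℝ) ^ 2) + δ
  have hτ : 0 < τ := by
    have : 0 ≤ ∑' n : ℕ, 1 / (n : ℝ) ^ 2 := tsum_nonneg fun n => by positivity
    positivity
  have hT : 2 * τ / 2 = τ := by ring
  have hT' : -(2 * τ) / 2 = -τ := by ring
  have hd := fun m : {m : ℤ // m ≠ 0} => differentiable_Psi N δ m.2
  have hK := fun m : {m : ℤ // m ≠ 0} => hΨ m m.2
  have hnorm : ∀ m : {m : ℤ // m ≠ 0}, eLpNorm (invFourier (Psi N δ m)) 2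
      (volume.restrict (Set.Ioo (-(2 * τ) / 2) (2 * τ / 2))) ≤
        -- The supremum of `|Θ_m|` is at most `C e^{b m⁶}/2`, since `∫ dx/(1 + x²) = π` meets the
        -- prefactor `1/(2π)`; the interval length `2τ` gives `√(2τ)`.
        ENNReal.ofReal (√(2 * τ) * C / 2 * Real.exp (b * ((m : ℤ) : ℝ) ^ 6)) := fun m =>
    (eLpNorm_two_Ioo_le (by positivity) (norm_invFourier_le (hK m))).trans
      (le_of_eq (by congr 1; ring))
  refine ⟨2 * τ, by positivity, √(2 * τ) * C / 2, b, by positivity, hb,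
    fun m => invFourier (Psi N δ m), ⟨fun m => ?_, fun n => ?_, fun m n => ?_⟩, hnorm, fun m => ?_⟩
  · exact ⟨(continuous_invFourier (hd m) (hK m)).aestronglyMeasurable,
      (hnorm m).trans_lt ENNReal.ofReal_lt_top⟩
  · refine MemLp.of_bound (C := 1) ?_ (Eventually.of_forall fun t => ?_)
    · exact Continuous.aestronglyMeasurable (by fun_prop)
    · dsimp only
      rw [exp_neg_eigval_mul, Complex.norm_exp]
      simp
  · rw [hT, hT']
    -- The pairing with `e^{-λ_n t}` is the Fourier transform of `Θ_m` at `μ_n`, which is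
    -- `Ψ_m(μ_n)`.
    have := integral_invFourier_mul_exp (hd m) (hK m) (dispersion n)
    rw [Psi_dispersion N δ m.2 n.2] at this
    simp only [Subtype.ext_iff]
    rw [← this]
    refine integral_congr_ae (Eventually.of_forall fun t => ?_)
    simp only [exp_neg_eigval_mul]
    rw [← Complex.exp_conj]
    simp
  · rw [hT, hT']
    refine ⟨multipliable_factorP m, multipliable_factorM (Int.natAbs_pos.2 m.2), ?_,
      entireOfExpType_of_strip_decay (hd m) hτ.le (hK m), fun n => ?_,
      integrable_of_strip_decay (hd m) (hK m), memLp_two_of_strip_decay (hd m) (hK m), rfl,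
      support_invFourier_subset (hd m) (hK m)⟩
    · rw [I_mul_eigval]
      exact prodM_dispersion_ne_zero m.2
    · rw [I_mul_eigval, Psi_dispersion N δ m.2 n.2]
      simp only [Subtype.ext_iff]
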